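/- Let $(X,d,\mu)$ and $(X',d',\mu')$ be metric spaces with locally finite Borel measures, and let $D\subset X$ and $D'\subset X'$ be domains (nonempty open path connected sets) of finite Hausdorff dimensions $\alpha$ and $\alpha'$. A Borel function $\varrho:X\to[0,\infty]$ is admissible for a family $\Gamma$ of paths if $\int_\gamma\varrho\,ds\ge 1$ for every rectifiable $\gamma\in\Gamma$. The modulus of a family $\Gamma$ of paths in $D$ is $M(\Gamma)=\inf\int_D\varrho^{\alpha}\,d\mu$ over all admissible $\varrho$; for families of paths in $D'$ one uses $\alpha'$, $\mu'$ and $D'$. For $E,F\subset D$, $\Delta(E,F;D)$ is the family of all paths joining $E$ and $F$ in $D$. The boundary $\partial D$ is weakly flat if for every $x_0\in\partial D$, every $P>0$ and every neighborhood $U$ of $x_0$ there is a neighborhood $V\subset U$ of $x_0$ with $M(\Delta(E,F;D))\ge P$ for all continua (compact connected sets) $E,F\subset D$ each of which intersects both $\partial U$ and $\partial V$; likewise for $\partial D'$. Given a measurable $Q:D\to[0,\infty]$, a homeomorphism $f:D\to D'$ is a $Q$-homeomorphism if $M(f\Gamma)\le\int_D Q\,\varrho^{\alpha}\,d\mu$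 for every family $\Gamma$ of paths in $D$ and every $\varrho$ admissible for $\Gamma$. Theorem. Let $D$ and $D'$ have weakly flat boundaries and compact closures. Suppose that $X$ is upper $\lambda_{x_0}(r)$-regular at every point $x_0\in\partial D$, that is, for every $x_0\in\partial D$ there are an increasing function $\lambda_{x_0}$ on $(0,\infty)$ and constants $C,r_0>0$ with $\mu(B(x_0,r))\le C\lambda_{x_0}(r)$ for all $0<r<r_0$, and suppose that for every $x_0\in\partial D$ $$\lambda_{x_0}(\varepsilon)=o\Bigl(\varepsilon^{\alpha}\log^{\alpha-1}\frac1\varepsilon\Bigr)\quad\text{as }\varepsilon\to0 .$$ Let $Q:D\to[0,\infty]$ be a measurable function with $\int_D Q\,d\mu<\infty$ and, for every $x_0\in\partial D$, $$\limsup_{\varepsilon\to0}\ \frac{1}{\mu(B(x_0,\varepsilon)\cap D)}\int_{B(x_0,\varepsilon)\cap D}Q(x)\,d\mu(x)<\infty ,$$ where the mean over a set of measure zero counts as $0$. Then every $Q$-homeomorphism $f:D\to D'$ extends to a homeomorphism $\overline f:\overline D\to\overline{D'}$. -/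

import Mathlib

open Set Filter Topology MeasureTheory Asymptotics
open scoped ENNReal NNReal unitInterval

noncomputable section

namespace MetricModulus

/-- The length of a path: the supremum of the sums of `d (γ tᵢ) (γ tᵢ₋₁)` over all partitions. -/
def pathLength {X : Type*} [MetricSpace X] (γ : C(I, X)) : ℝ≥0∞ :=
  eVariationOn γ univ

/-- A path is rectifiable if its length is finite. -/
def IsRectifiable {X : Type*} [MetricSpace X] (γ : C(I, X)) : Prop :=
  pathLength γ ≠ ⊤

/-- The integral of `ρ` along `γ` with respect to arc length. For a rectifiable path `γ`
of length `ℓ`, this is the integral of `ρ ∘ γₛ` over `[0, ℓ]`, where `γₛ` is the arc-length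
parametrization of `γ`. It is only used for rectifiable paths. -/
def lineIntegral {X : Type*} [MetricSpace X] (ρ : X → ℝ≥0∞) (γ : C(I, X)) : ℝ≥0∞ :=
  ∫⁻ t in Icc (0 : ℝ) (pathLength γ).toReal, ρ (naturalParameterization γ univ 0 t)

/-- `ρ` is admissible for the path family `Γ`: it is a Borel function with values in `[0, ∞]`
whose integral along every rectifiable path of `Γ` is at least `1`. -/
def Admissible {X : Type*} [MetricSpace X] [MeasurableSpace X]
    (Γ : Set C(I, X)) (ρ : X → ℝ≥0∞) : Prop :=
  Measurable ρ ∧ ∀ γ ∈ Γ, IsRectifiable γ → 1 ≤ lineIntegral ρ γ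

/-- The Hausdorff dimension of `D` as a real number (meaningful when it is finite). -/
def hdim {X : Type*} [MetricSpace X] (D : Set X) : ℝ :=
  (dimH D).toReal

/-- The modulus of a family `Γ` of paths in `D`; the exponent is the Hausdorff dimension of `D`. -/
def modulus {X : Type*} [MetricSpace X] [MeasurableSpace X] (μ : Measure X)
    (D : Set X) (Γ : Set C(I, X)) : ℝ≥0∞ :=
  ⨅ (ρ : X → ℝ≥0∞) (_ : Admissible Γ ρ), ∫⁻ x in D, ρ x ^ hdim D ∂μ

/-- The family `Δ(E, F; D)` of all paths joining `E` and `F` in `D`. -/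
def joining {X : Type*} [MetricSpace X] (E F D : Set X) : Set C(I, X) :=
  {γ | γ 0 ∈ E ∧ γ 1 ∈ F ∧ ∀ t ∈ Ioo (0 : I) 1, γ t ∈ D}

/-- A domain: an open set, any two points of which can be joined by a path in the set. -/
def IsDomainIn {X : Type*} [MetricSpace X] (D : Set X) : Prop :=
  IsOpen D ∧ IsPathConnected D

/-- A continuum: a compact connected set. -/
def IsContinuum {X : Type*} [MetricSpace X] (E : Set X) : Prop :=
  IsCompact E ∧ IsConnected E

/-- The boundary of `D` is weakly flat at the point `x₀`. -/
def WeaklyFlatAt {X : Type*} [MetricSpace X] [MeasurableSpace X] (μ : Measure X)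
    (D : Set X) (x₀ : X) : Prop :=
  ∀ P : ℝ≥0, 0 < P → ∀ U ∈ 𝓝 x₀, ∃ V ∈ 𝓝 x₀, V ⊆ U ∧
    ∀ E F : Set X, IsContinuum E → IsContinuum F → E ⊆ D → F ⊆ D →
      (E ∩ frontier U).Nonempty → (E ∩ frontier V).Nonempty →
      (F ∩ frontier U).Nonempty → (F ∩ frontier V).Nonempty →
      (P : ℝ≥0∞) ≤ modulus μ D (joining E F D)

/-- The boundary of `D` is weakly flat (at each of its points). -/
def WeaklyFlatBoundary {X : Type*} [MetricSpace X] [MeasurableSpace X] (μ : Measure X)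
    (D : Set X) : Prop :=
  ∀ x₀ ∈ frontier D, WeaklyFlatAt μ D x₀

/-- The inclusion of a subset as a continuous map. -/
def incl {X : Type*} [MetricSpace X] (D : Set X) : C(D, X) :=
  ⟨Subtype.val, continuous_subtype_val⟩

/-- A family of paths in `D`, regarded as a family of paths in the ambient space. -/
def ambient {X : Type*} [MetricSpace X] {D : Set X} (Γ : Set C(I, D)) : Set C(I, X) :=
  (fun γ => (incl D).comp γ) '' Γ

/-- The image `f Γ` of a family of paths in `D` under a homeomorphism `f : D → D'`. -/
def imageFamily {X X' : Type*} [MetricSpace X] [MetricSpace X'] {D : Set X} {D' : Set X'}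
    (f : D ≃ₜ D') (Γ : Set C(I, D)) : Set C(I, D') :=
  (fun γ => (f : C(D, D')).comp γ) '' Γ

/-- `f : D → D'` is a `Q`-homeomorphism: `M(f Γ) ≤ ∫_D Q ρ ^ α dμ` for every family `Γ` of paths
in `D` and every `ρ` admissible for `Γ`. Here `α` is the Hausdorff dimension of `D`, and the
modulus on the left is taken in `D'`. Only the values of `Q` on `D` matter. -/
def IsQHomeo {X X' : Type*} [MetricSpace X] [MeasurableSpace X] [MetricSpace X']
    [MeasurableSpace X'] (μ : Measure X) (μ' : Measure X') {D : Set X} {D' : Set X'}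
    (Q : X → ℝ≥0∞) (f : D ≃ₜ D') : Prop :=
  ∀ (Γ : Set C(I, D)) (ρ : X → ℝ≥0∞), Admissible (ambient Γ) ρ →
    modulus μ' D' (ambient (imageFamily f Γ)) ≤ ∫⁻ x in D, Q x * ρ x ^ hdim D ∂μ

/-- The space is upper `lam(r)`-regular at `x₀`: `lam` is increasing on `(0, ∞)` and
`μ (B(x₀, r)) ≤ C * lam r` for all sufficiently small radii `r`. -/
def UpperRegularAt {X : Type*} [MetricSpace X] [MeasurableSpace X] (μ : Measure X)
    (lam : ℝ → ℝ) (x₀ : X) : Prop :=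
  MonotoneOn lam (Ioi 0) ∧ ∃ C : ℝ, 0 < C ∧ ∃ r₀ : ℝ, 0 < r₀ ∧
    ∀ r : ℝ, 0 < r → r < r₀ → μ (Metric.ball x₀ r) ≤ ENNReal.ofReal (C * lam r)

/-- The mean values of `Q` over `B(x₀, ε) ∩ D` have a finite upper limit as `ε → 0`
(a mean over a set of measure zero counts as `0`). -/
def BoundedMeansAt {X : Type*} [MetricSpace X] [MeasurableSpace X] (μ : Measure X)
    (D : Set X) (Q : X → ℝ≥0∞) (x₀ : X) : Prop :=
  limsup (fun ε : ℝ => (∫⁻ x in Metric.ball x₀ ε ∩ D, Q x ∂μ) / μ (Metric.ball x₀ ε ∩ D))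
    (𝓝[>] 0) < ⊤

end MetricModulus

end

/-! A homeomorphism of `D` onto `D'` extends to the compact closures once its cluster set at each
boundary point is a single point and these points differ for different boundary points
(`exists_homeomorph_closure`). Both facts come from comparing moduli: weak flatness of the boundary
of `D'` makes the modulus between two continua crossing a thick ring near a boundary point large,
while the `Q`-inequality bounds it by an integral over `D`.

Preimages of such continua must stay near a boundary point of `D`. This works because weak flatness
makes `D` locally path connected there (`WeaklyFlatAt.exists_joinedIn`).

If distinct boundary points shared a cluster value, the two preimages would lie a positive distance
apart, so a constant test function would give a finite bound, since `Q` is integrable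
(`IsQHomeo.eq_of_mapClusterPt`).

If one boundary point `x₀` had two cluster values, one preimage could be fixed away from `x₀` and
the other pushed towards `x₀`. The test function is then a dyadic version of `1 / (|x - x₀| log (1 /
|x - x₀|))`. Its integral against `Q` is arbitrarily small by the growth condition on `lam` and the
bounded means of `Q`, and divergence of the harmonic series makes it admissible
(`exists_admissible_lintegral_le`, `IsQHomeo.mapClusterPt_unique`). -/

namespace MetricModulus

/-! ### Arc length and the cost of crossing shells -/

section Paths

variable {X : Type*} [MetricSpace X]

theorem IsRectifiable.boundedVariationOn {γ : C(I, X)} (h : IsRectifiable γ) :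
    BoundedVariationOn γ univ := h

theorem IsRectifiable.continuous_variationOnFromTo {γ : C(I, X)} (h : IsRectifiable γ) :
    Continuous (variationOnFromTo γ univ 0) := by
  have hl := h.boundedVariationOn.locallyBoundedVariationOn
  rw [continuous_iff_continuousAt]
  intro x
  have h1 := h.boundedVariationOn.tendsto_eVariationOn_Icc_zero_left (x := x)
    γ.continuous.continuousWithinAt
  have h2 := h.boundedVariationOn.tendsto_eVariationOn_Icc_zero_right x
    γ.continuous.continuousWithinAt
  have h1' := (ENNReal.tendsto_toReal ENNReal.zero_ne_top).comp h1
  have h2' := (ENNReal.tendsto_toReal ENNReal.zero_ne_top).comp h2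
  have h3 := h1'.add h2'
  rw [nhdsWithin_univ] at h3
  simp only [ENNReal.toReal_zero, add_zero] at h3
  -- On whichever side of `x` the point `y` lies, the signed variation is, up to sign, one of the
  -- two one-sided variations, so their sum dominates it.
  have h4 : Tendsto (variationOnFromTo γ univ x) (𝓝 x) (𝓝 0) := by
    refine squeeze_zero_norm (fun y => ?_) h3
    simp only [Function.comp_apply, variationOnFromTo]
    split_ifs
    · simp [ENNReal.toReal_nonneg]
    · simp [ENNReal.toReal_nonneg]
  have h5 : variationOnFromTo γ univ 0 =
      fun y => variationOnFromTo γ univ 0 x + variationOnFromTo γ univ x y := by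
    ext y
    rw [variationOnFromTo.add hl (mem_univ _) (mem_univ _) (mem_univ _)]
  rw [ContinuousAt, h5]
  simpa [variationOnFromTo.self] using h4.const_add (variationOnFromTo γ univ 0 x)

theorem IsRectifiable.isCompact_range_variationOnFromTo {γ : C(I, X)} (h : IsRectifiable γ) :
    IsCompact (range (variationOnFromTo γ univ 0)) :=
  isCompact_range h.continuous_variationOnFromTo

theorem IsRectifiable.range_variationOnFromTo_subset {γ : C(I, X)} (h : IsRectifiable γ) :
    range (variationOnFromTo γ univ 0) ⊆ Icc 0 (pathLength γ).toReal := by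
  rintro _ ⟨t, rfl⟩
  exact ⟨variationOnFromTo.nonneg_of_le _ _ t.2.1,
    (le_abs_self _).trans (variationOnFromTo.abs_le_eVariationOn h.boundedVariationOn)⟩

theorem IsRectifiable.naturalParameterization_variationOnFromTo {γ : C(I, X)}
    (h : IsRectifiable γ) (t : I) :
    naturalParameterization γ univ 0 (variationOnFromTo γ univ 0 t) = γ t :=
  edist_eq_zero.1 (edist_naturalParameterization_eq_zero
    h.boundedVariationOn.locallyBoundedVariationOn (mem_univ _) (mem_univ t))

theorem IsRectifiable.lipschitzOnWith_naturalParameterization {γ : C(I, X)}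
    (h : IsRectifiable γ) :
    LipschitzOnWith 1 (naturalParameterization γ univ 0)
      (range (variationOnFromTo γ univ 0)) := by
  have hu := has_unit_speed_naturalParameterization γ
    h.boundedVariationOn.locallyBoundedVariationOn (mem_univ (0 : I))
  rw [image_univ] at hu
  have key : ∀ x ∈ range (variationOnFromTo γ univ 0),
      ∀ y ∈ range (variationOnFromTo γ univ 0), x ≤ y →
      edist (naturalParameterization γ univ 0 x) (naturalParameterization γ univ 0 y) ≤
        edist x y := by
    intro x hx y hy hxy
    calc _ ≤ eVariationOn (naturalParameterization γ univ 0)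
          (range (variationOnFromTo γ univ 0) ∩ Icc x y) :=
          eVariationOn.edist_le _ ⟨hx, le_rfl, hxy⟩ ⟨hy, hxy, le_rfl⟩
      _ = ENNReal.ofReal (y - x) := by rw [hu hx hy]; simp
      _ = edist x y := by
        rw [edist_comm, edist_dist, Real.dist_eq, abs_of_nonneg (sub_nonneg.2 hxy)]
  intro x hx y hy
  rw [ENNReal.coe_one, one_mul]
  rcases le_total x y with hxy | hxy
  · exact key x hx y hy hxy
  · rw [edist_comm, edist_comm x]
    exact key y hy x hx hxy

theorem edist_le_pathLength (γ : C(I, X)) (s t : I) : edist (γ s) (γ t) ≤ pathLength γ :=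
  eVariationOn.edist_le _ (mem_univ _) (mem_univ _)

theorem lineIntegral_const {γ : C(I, X)} (h : IsRectifiable γ) (c : ℝ≥0∞) :
    lineIntegral (fun _ => c) γ = c * pathLength γ := by
  simp [lineIntegral, ENNReal.ofReal_toReal h]

theorem admissible_const [MeasurableSpace X] {Γ : Set C(I, X)} {δ : ℝ} (hδ : 0 < δ)
    (h : ∀ γ ∈ Γ, ∃ s t, δ ≤ dist (γ s) (γ t)) :
    Admissible Γ (fun _ => ENNReal.ofReal δ⁻¹) := by
  refine ⟨measurable_const, fun γ hγ hr => ?_⟩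
  obtain ⟨s, t, hst⟩ := h γ hγ
  rw [lineIntegral_const hr]
  calc (1 : ℝ≥0∞) = ENNReal.ofReal δ⁻¹ * ENNReal.ofReal δ := by
        rw [← ENNReal.ofReal_mul (by positivity), inv_mul_cancel₀ hδ.ne', ENNReal.ofReal_one]
    _ ≤ _ := by
      gcongr
      refine le_trans ?_ (edist_le_pathLength γ s t)
      rw [edist_dist]
      exact ENNReal.ofReal_le_ofReal hst

/-- The half-open spherical shell `a ≤ d(x, x₀) < b`. -/
def shell (x₀ : X) (a b : ℝ) : Set X := {x | a ≤ dist x x₀ ∧ dist x x₀ < b}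

theorem measurableSet_shell [MeasurableSpace X] [BorelSpace X] (x₀ : X) (a b : ℝ) :
    MeasurableSet (shell x₀ a b) := by
  have h : Measurable fun x : X => dist x x₀ := (continuous_id.dist continuous_const).measurable
  exact (measurableSet_le measurable_const h).inter (measurableSet_lt h measurable_const)

/-- A rectifiable path crossing a shell spends at least the width of the shell in it. -/
theorem IsRectifiable.exists_measurableSet_shell {γ : C(I, X)} (h : IsRectifiable γ) {x₀ : X}
    {a b : ℝ} {s t : I} (hs : dist (γ s) x₀ ≤ a) (ht : b ≤ dist (γ t) x₀) :
    ∃ M : Set ℝ, MeasurableSet M ∧ M ⊆ Icc 0 (pathLength γ).toReal ∧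
      MapsTo (naturalParameterization γ univ 0) M (shell x₀ a b) ∧
      ENNReal.ofReal (b - a) ≤ volume M := by
  set A := range (variationOnFromTo γ univ 0) with hA
  set η := naturalParameterization γ univ 0 with hη
  have hAc : IsClosed A := h.isCompact_range_variationOnFromTo.isClosed
  have hL : LipschitzOnWith 1 (fun r => dist (η r) x₀) A := by
    have := (LipschitzWith.dist_left x₀).comp_lipschitzOnWith
      h.lipschitzOnWith_naturalParameterization
    rw [mul_one] at this
    exact this
  have hcl : ∀ c, MeasurableSet (A ∩ (fun r => dist (η r) x₀) ⁻¹' Ici c) := fun c =>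
    (hL.continuousOn.preimage_isClosed_of_isClosed hAc isClosed_Ici).measurableSet
  -- Restricting to the range `A` of the arc-length function matters: the parametrization is
  -- controlled only there. On `A` it is 1-Lipschitz, so the set is a difference of two closed sets.
  refine ⟨A ∩ {r | η r ∈ shell x₀ a b}, ?_, ?_, ?_, ?_⟩
  · convert (hcl a).diff (hcl b) using 1
    ext r
    constructor
    · rintro ⟨h1, h2, h3⟩
      exact ⟨⟨h1, h2⟩, fun h4 => h3.not_ge h4.2⟩
    · rintro ⟨⟨h1, h2⟩, h3⟩
      exact ⟨h1, h2, not_le.1 fun h4 => h3 ⟨h1, h4⟩⟩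
  · exact inter_subset_left.trans h.range_variationOnFromTo_subset
  · exact fun r hr => hr.2
  · have himg : Ico a b ⊆ (fun r => dist (η r) x₀) '' (A ∩ {r | η r ∈ shell x₀ a b}) := by
      intro c hc
      have hcont : Continuous fun u => dist (γ u) x₀ := by fun_prop
      obtain ⟨u, hu⟩ := intermediate_value_univ s t hcont ⟨hs.trans hc.1, hc.2.le.trans ht⟩
      have hu' : dist (η (variationOnFromTo γ univ 0 u)) x₀ = c := by
        rw [hη, h.naturalParameterization_variationOnFromTo]; exact hu
      refine ⟨variationOnFromTo γ univ 0 u, ⟨mem_range_self _, ?_⟩, hu'⟩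
      change a ≤ dist _ x₀ ∧ dist _ x₀ < b
      rw [hu']
      exact hc
    calc ENNReal.ofReal (b - a) = volume (Ico a b) := by simp
      _ ≤ volume ((fun r => dist (η r) x₀) '' (A ∩ {r | η r ∈ shell x₀ a b})) :=
        measure_mono himg
      _ ≤ volume (A ∩ {r | η r ∈ shell x₀ a b}) := by
        have := (hL.mono inter_subset_left).hausdorffMeasure_image_le
          (s := A ∩ {r | η r ∈ shell x₀ a b}) zero_le_one
        simpa [hausdorffMeasure_real] using this

/-- The measurable sets of parameters `M k` stand in for the preimages of the shells, so that the
sum can leave the integral without measurability of the parametrization off its controlled range. -/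
theorem sum_le_lineIntegral_shell {γ : C(I, X)} (h : IsRectifiable γ) {x₀ : X} {ι : Type*}
    (K : Finset ι) (a b : ι → ℝ) (c : ι → ℝ≥0∞)
    (hin : ∀ k ∈ K, ∃ s, dist (γ s) x₀ ≤ a k) (hout : ∀ k ∈ K, ∃ t, b k ≤ dist (γ t) x₀) :
    ∑ k ∈ K, c k * ENNReal.ofReal (b k - a k) ≤
      lineIntegral (fun x => ∑ k ∈ K, (shell x₀ (a k) (b k)).indicator (fun _ => c k) x) γ := by
  have : ∀ k, ∃ M : Set ℝ, k ∈ K → MeasurableSet M ∧ M ⊆ Icc 0 (pathLength γ).toReal ∧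
      MapsTo (naturalParameterization γ univ 0) M (shell x₀ (a k) (b k)) ∧
      ENNReal.ofReal (b k - a k) ≤ volume M := by
    intro k
    by_cases hk : k ∈ K
    · obtain ⟨s, hs⟩ := hin k hk
      obtain ⟨t, ht⟩ := hout k hk
      obtain ⟨M, hM⟩ := h.exists_measurableSet_shell hs ht
      exact ⟨M, fun _ => hM⟩
    · exact ⟨∅, fun h => (hk h).elim⟩
  choose M hM using this
  calc ∑ k ∈ K, c k * ENNReal.ofReal (b k - a k)
      ≤ ∑ k ∈ K, ∫⁻ t in Icc 0 (pathLength γ).toReal, (M k).indicator (fun _ => c k) t := by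
        refine Finset.sum_le_sum fun k hk => ?_
        obtain ⟨h1, h2, -, h4⟩ := hM k hk
        rw [lintegral_indicator_const h1, Measure.restrict_apply h1, inter_eq_left.2 h2]
        gcongr
    _ = ∫⁻ t in Icc 0 (pathLength γ).toReal, ∑ k ∈ K, (M k).indicator (fun _ => c k) t := by
        rw [lintegral_finsetSum' _ fun k hk =>
          (measurable_const.indicator (hM k hk).1).aemeasurable]
    _ ≤ _ := by
        refine lintegral_mono fun t => Finset.sum_le_sum fun k hk => ?_
        by_cases ht : t ∈ M k
        · rw [indicator_of_mem ht, indicator_of_mem ((hM k hk).2.2.1 ht)]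
        · rw [indicator_of_notMem ht]; exact zero_le

end Paths

end MetricModulus

namespace MetricModulus

/-! ### Continua and dimension of domains -/

section Topology

theorem inter_frontier_nonempty {X : Type*} [TopologicalSpace X] {E V : Set X}
    (hE : IsPreconnected E) {x y : X} (hx : x ∈ E) (hxV : x ∈ interior V) (hy : y ∈ E)
    (hyV : y ∉ V) : (E ∩ frontier V).Nonempty := by
  by_contra h
  have hsub : E ⊆ interior V ∪ (closure V)ᶜ := by
    intro z hz
    by_contra hz'
    rw [mem_union, not_or, notMem_compl_iff] at hz'
    exact h ⟨z, hz, hz'.2, hz'.1⟩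
  have := hE.subset_left_of_subset_union isOpen_interior isClosed_closure.isOpen_compl
    (disjoint_compl_right.mono_left (interior_subset.trans subset_closure)) hsub ⟨x, hx, hxV⟩
  exact hyV (interior_subset (this hy))

variable {X : Type*} [MetricSpace X]

/-- The distance to `x` is 1-Lipschitz and its image of the connected set `D` contains a
nondegenerate interval, of dimension 1. -/
theorem one_le_hdim {D : Set X} (hD : IsPathConnected D) (hfin : dimH D ≠ ⊤)
    {x y : X} (hx : x ∈ D) (hy : y ∈ D) (hxy : x ≠ y) : 1 ≤ hdim D := by
  have h1 : Icc 0 (dist y x) ⊆ (fun z => dist z x) '' D := by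
    have := hD.isConnected.isPreconnected.intermediate_value hx hy
      (f := fun z => dist z x) (by fun_prop)
    simpa using this
  have h2 : dimH (Icc 0 (dist y x)) = 1 := by
    rw [Real.dimH_of_nonempty_interior]
    · simp
    · rw [interior_Icc, nonempty_Ioo]
      exact dist_pos.2 hxy.symm
  have h3 : (1 : ℝ≥0∞) ≤ dimH D := by
    rw [← h2]
    exact (dimH_mono h1).trans ((LipschitzWith.dist_left x).dimH_image_le D)
  simpa [hdim] using ENNReal.toReal_mono hfin h3

/-- The path is cut at the first time its distance to `x₀` equals `s`. -/
theorem exists_isPathConnected_subset_closedBall {D : Set X} {x₀ z p : X} {s : ℝ}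
    (hzp : JoinedIn D z p) (hz : dist z x₀ ≤ s) (hp : s ≤ dist p x₀) :
    ∃ E ⊆ D ∩ Metric.closedBall x₀ s, IsCompact E ∧ IsPathConnected E ∧ z ∈ E ∧
      ∃ w ∈ E, s ≤ dist w x₀ := by
  obtain ⟨γ, hγ⟩ := hzp
  set g : ℝ → ℝ := fun t => dist (γ.extend t) x₀ with hg
  have hgc : Continuous g := γ.continuous_extend.dist continuous_const
  have hg0 : g 0 = dist z x₀ := by simp [hg]
  have hg1 : g 1 = dist p x₀ := by simp [hg]
  have hne : (Icc (0 : ℝ) 1 ∩ g ⁻¹' {s}).Nonempty := by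
    obtain ⟨t, ht, hts⟩ := intermediate_value_Icc zero_le_one hgc.continuousOn
      (show s ∈ Icc (g 0) (g 1) by rw [hg0, hg1]; exact ⟨hz, hp⟩)
    exact ⟨t, ht, hts⟩
  have hcp : IsCompact (Icc (0 : ℝ) 1 ∩ g ⁻¹' {s}) :=
    isCompact_Icc.inter_right (isClosed_singleton.preimage hgc)
  obtain ⟨T, ⟨hT, hTs⟩, hTmin⟩ := hcp.exists_isLeast hne
  refine ⟨γ.extend '' Icc 0 T, ?_, isCompact_Icc.image γ.continuous_extend,
    ((convex_Icc 0 T).isPathConnected (nonempty_Icc.2 hT.1)).image γ.continuous_extend,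
    ⟨0, ⟨le_rfl, hT.1⟩, by simp⟩, γ.extend T, ⟨T, ⟨hT.1, le_rfl⟩, rfl⟩, ?_⟩
  · rintro _ ⟨t, ht, rfl⟩
    have ht1 : t ∈ Icc (0 : ℝ) 1 := ⟨ht.1, ht.2.trans hT.2⟩
    refine ⟨by rw [γ.extend_apply ht1]; exact hγ _, ?_⟩
    rw [Metric.mem_closedBall]
    by_contra! hlt
    obtain ⟨u, hu, hus⟩ := intermediate_value_Icc ht.1 hgc.continuousOn
      (show s ∈ Icc (g 0) (g t) by rw [hg0]; exact ⟨hz, hlt.le⟩)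
    have huT : T ≤ u := hTmin ⟨⟨hu.1, hu.2.trans ht1.2⟩, hus⟩
    have hut : u = t := le_antisymm hu.2 (ht.2.trans huT)
    rw [hut] at hus
    exact hlt.ne' hus
  · exact (show g T = s from hTs).ge

theorem joinedIn_of_continuousMap {A : Set X} (γ : C(I, X)) (h : ∀ t, γ t ∈ A) :
    JoinedIn A (γ 0) (γ 1) :=
  ⟨⟨γ, rfl, rfl⟩, h⟩

theorem mem_of_mem_joining {E F D : Set X} (hE : E ⊆ D) (hF : F ⊆ D) {γ : C(I, X)}
    (hγ : γ ∈ joining E F D) (t : I) : γ t ∈ D := by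
  rcases eq_or_ne t 0 with rfl | h0
  · exact hE hγ.1
  rcases eq_or_ne t 1 with rfl | h1
  · exact hF hγ.2.1
  exact hγ.2.2 t ⟨unitInterval.pos_iff_ne_zero.2 h0, unitInterval.lt_one_iff_ne_one.2 h1⟩

end Topology

/-! ### Modulus estimates and local connectedness at the boundary -/

section Modulus

variable {X : Type*} [MetricSpace X] [MeasurableSpace X] {μ : Measure X} {D : Set X}

theorem modulus_le_of_admissible {Γ : Set C(I, X)} {ρ : X → ℝ≥0∞} (h : Admissible Γ ρ) :
    modulus μ D Γ ≤ ∫⁻ x in D, ρ x ^ hdim D ∂μ :=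
  iInf₂_le ρ h

theorem modulus_mono {Γ Γ' : Set C(I, X)} (h : Γ ⊆ Γ') : modulus μ D Γ ≤ modulus μ D Γ' :=
  le_iInf₂ fun _ hρ => modulus_le_of_admissible ⟨hρ.1, fun γ hγ => hρ.2 γ (h hγ)⟩

/-- Near a point where it is weakly flat, a domain is locally path connected. -/
theorem WeaklyFlatAt.exists_joinedIn {x₀ : X} (h : WeaklyFlatAt μ D x₀)
    (hD : IsPathConnected D) (hμ : μ D ≠ ⊤) {r : ℝ} (hr : 0 < r) :
    ∃ δ > 0, ∀ x ∈ D, ∀ y ∈ D, dist x x₀ < δ → dist y x₀ < δ →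
      JoinedIn (D ∩ Metric.ball x₀ r) x y := by
  by_cases hsub : D ⊆ Metric.ball x₀ r
  · refine ⟨1, one_pos, fun x hx y hy _ _ => ?_⟩
    rw [inter_eq_left.2 hsub]
    exact hD.joinedIn x hx y hy
  obtain ⟨p, hpD, hp⟩ := not_subset.1 hsub
  rw [Metric.mem_ball, not_lt] at hp
  set c : ℝ≥0∞ := ENNReal.ofReal (r / 4)⁻¹ with hc
  have hM : c ^ hdim D * μ D ≠ ⊤ :=
    ENNReal.mul_ne_top (ENNReal.rpow_ne_top_of_nonneg ENNReal.toReal_nonneg ENNReal.ofReal_ne_top)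
      hμ
  -- Flatness is used at radius `r / 2`, the continua stop at `3 * r / 4`, and a path leaving the
  -- ball of radius `r` from there has length at least `r / 4`. Hence the choice of `c`, and a `P`
  -- exceeding the resulting bound.
  obtain ⟨V, hV, hVU, hfl⟩ := h ((c ^ hdim D * μ D).toNNReal + 1) (by positivity)
    (Metric.ball x₀ (r / 2)) (Metric.ball_mem_nhds _ (by positivity))
  obtain ⟨δ, hδ, hδV⟩ := Metric.mem_nhds_iff.1 hV
  refine ⟨δ, hδ, fun x hx y hy hxδ hyδ => ?_⟩
  have hcont : ∀ z ∈ D, dist z x₀ < δ → ∃ E ⊆ D ∩ Metric.closedBall x₀ (3 * r / 4),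
      IsContinuum E ∧ IsPathConnected E ∧ z ∈ E ∧
      (E ∩ frontier (Metric.ball x₀ (r / 2))).Nonempty ∧ (E ∩ frontier V).Nonempty := by
    intro z hz hzδ
    have hzV : z ∈ interior V := interior_maximal hδV Metric.isOpen_ball hzδ
    have hzU := hVU (interior_subset hzV)
    have hzU' : dist z x₀ < r / 2 := hzU
    obtain ⟨E, hE, hEc, hEp, hzE, w, hw, hws⟩ := exists_isPathConnected_subset_closedBall
      (x₀ := x₀) (s := 3 * r / 4) (hD.joinedIn z hz p hpD) (by linarith) (by linarith)
    have hwU : w ∉ Metric.ball x₀ (r / 2) := by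
      rw [Metric.mem_ball, not_lt]; linarith
    exact ⟨E, hE, ⟨hEc, hEp.isConnected⟩, hEp, hzE,
      inter_frontier_nonempty hEp.isConnected.isPreconnected hzE
        (by rwa [Metric.isOpen_ball.interior_eq]) hw hwU,
      inter_frontier_nonempty hEp.isConnected.isPreconnected hzE hzV hw fun h => hwU (hVU h)⟩
  obtain ⟨E, hE, hEc, hEp, hxE, hEU, hEV⟩ := hcont x hx hxδ
  obtain ⟨F, hF, hFc, hFp, hyF, hFU, hFV⟩ := hcont y hy hyδ
  have hED := hE.trans inter_subset_left
  have hFD := hF.trans inter_subset_left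
  have hball : D ∩ Metric.closedBall x₀ (3 * r / 4) ⊆ D ∩ Metric.ball x₀ r :=
    inter_subset_inter_right _ (Metric.closedBall_subset_ball (by linarith))
  by_contra hnj
  have hadm : Admissible (joining E F D) fun _ => c := by
    refine admissible_const (by positivity) fun γ hγ => ?_
    -- A path from `E` to `F` inside the ball would join `x` to `y` through `E` and `F`.
    obtain ⟨t, ht⟩ : ∃ t, γ t ∉ Metric.ball x₀ r := by
      by_contra! hall
      refine hnj (((hEp.joinedIn x hxE _ hγ.1).mono (hE.trans hball)).trans
        ((joinedIn_of_continuousMap γ fun t => ?_).trans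
          ((hFp.joinedIn _ hγ.2.1 y hyF).mono (hF.trans hball))))
      exact ⟨mem_of_mem_joining hED hFD hγ t, hall t⟩
    refine ⟨0, t, ?_⟩
    rw [Metric.mem_ball, not_lt] at ht
    have h0 : dist (γ 0) x₀ ≤ 3 * r / 4 := (hE hγ.1).2
    have := dist_triangle_left (γ t) x₀ (γ 0)
    linarith
  have h1 := (hfl E F hEc hFc hED hFD hEU hEV hFU hFV).trans (modulus_le_of_admissible hadm)
  rw [setLIntegral_const, ENNReal.coe_add, ENNReal.coe_toNNReal hM] at h1
  exact (ENNReal.lt_add_right hM one_ne_zero).not_ge h1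

variable {X' : Type*} [MetricSpace X'] [MeasurableSpace X'] {μ' : Measure X'} {D' : Set X'}

/-- Every path joining `E` and `F` in `D'`, endpoints included, is the image under `f` of a path in
`D`. -/
theorem IsQHomeo.modulus_joining_le {Q : X → ℝ≥0∞} {f : D ≃ₜ D'} (hf : IsQHomeo μ μ' Q f)
    {E F : Set X'} (hE : E ⊆ D') (hF : F ⊆ D') {ρ : X → ℝ≥0∞}
    (hρ : Admissible (ambient {γ : C(I, D) | (f (γ 0) : X') ∈ E ∧ (f (γ 1) : X') ∈ F}) ρ) :
    modulus μ' D' (joining E F D') ≤ ∫⁻ x in D, Q x * ρ x ^ hdim D ∂μ := by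
  refine (modulus_mono ?_).trans (hf _ ρ hρ)
  intro β hβ
  let β' : C(I, D') := ⟨fun t => ⟨β t, mem_of_mem_joining hE hF hβ t⟩,
    β.continuous.subtype_mk _⟩
  refine ⟨β', ⟨(f.symm : C(D', D)).comp β', ⟨?_, ?_⟩, ?_⟩, ?_⟩
  · simpa [β'] using hβ.1
  · simpa [β'] using hβ.2.1
  · ext t; simp
  · ext t; simp [β', incl]

end Modulus

end MetricModulus

namespace MetricModulus

/-! ### The logarithmic test function -/

variable {X : Type*} [MetricSpace X] [MeasurableSpace X] {μ : Measure X} {D : Set X}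

theorem BoundedMeansAt.exists_lintegral_le {Q : X → ℝ≥0∞} {x₀ : X}
    (h : BoundedMeansAt μ D Q x₀) :
    ∃ K : ℝ≥0, ∀ᶠ ε : ℝ in 𝓝[>] 0,
      ∫⁻ x in Metric.ball x₀ ε ∩ D, Q x ∂μ ≤ K * μ (Metric.ball x₀ ε ∩ D) := by
  obtain ⟨K, hK, hKtop⟩ := exists_between h
  refine ⟨K.toNNReal, ?_⟩
  filter_upwards [eventually_lt_of_limsup_lt hK] with ε hε
  rw [ENNReal.coe_toNNReal hKtop.ne]
  by_cases h0 : μ (Metric.ball x₀ ε ∩ D) = 0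
  · rw [setLIntegral_measure_zero _ _ h0]; exact zero_le
  · exact (ENNReal.div_le_iff_le_mul (Or.inl h0) (Or.inr (pos_of_gt hK).ne')).1 hε.le

theorem eventually_lintegral_ball_le {Q : X → ℝ≥0∞} {x₀ : X} {lam : ℝ → ℝ} {α : ℝ}
    (hreg : UpperRegularAt μ lam x₀)
    (hlam : lam =o[𝓝[>] 0] fun ε : ℝ => ε ^ α * Real.log (1 / ε) ^ (α - 1))
    (hQ : BoundedMeansAt μ D Q x₀) {η : ℝ} (hη : 0 < η) :
    ∀ᶠ ε : ℝ in 𝓝[>] 0, ∫⁻ x in Metric.ball x₀ ε ∩ D, Q x ∂μ ≤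
      ENNReal.ofReal (η * (ε ^ α * Real.log (1 / ε) ^ (α - 1))) := by
  obtain ⟨-, C, hC, r₀, hr₀, hball⟩ := hreg
  obtain ⟨K, hK⟩ := hQ.exists_lintegral_le
  -- The `+ 1` keeps the denominator positive when `K = 0`.
  have hc : 0 < η / (K * C + 1) := by positivity
  filter_upwards [hK, hlam.bound hc, self_mem_nhdsWithin,
    mem_nhdsWithin_of_mem_nhds (Iio_mem_nhds hr₀),
    mem_nhdsWithin_of_mem_nhds (Iio_mem_nhds one_pos)] with ε h1 h2 h3 h4 h5
  rw [mem_Ioi] at h3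
  rw [mem_Iio] at h4 h5
  have hlog : 0 ≤ Real.log (1 / ε) := Real.log_nonneg ((one_le_div h3).2 h5.le)
  set T := ε ^ α * Real.log (1 / ε) ^ (α - 1) with hT
  have hT0 : 0 ≤ T := by positivity
  rw [Real.norm_eq_abs, Real.norm_eq_abs, abs_of_nonneg hT0] at h2
  calc ∫⁻ x in Metric.ball x₀ ε ∩ D, Q x ∂μ ≤ K * μ (Metric.ball x₀ ε ∩ D) := h1
    _ ≤ K * ENNReal.ofReal (C * lam ε) := by
      gcongr
      exact (measure_mono inter_subset_left).trans (hball ε h3 h4)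
    _ = ENNReal.ofReal (K * (C * lam ε)) := by
      rw [ENNReal.ofReal_mul (NNReal.coe_nonneg K), ENNReal.ofReal_coe_nnreal]
    _ ≤ _ := by
      refine ENNReal.ofReal_le_ofReal ?_
      calc (K : ℝ) * (C * lam ε) ≤ K * (C * (η / (K * C + 1) * T)) := by
            gcongr
            exact (le_abs_self _).trans h2
        _ = (K * C) / (K * C + 1) * (η * T) := by ring
        _ ≤ 1 * (η * T) := by
            gcongr
            rw [div_le_one (by positivity)]
            linarith
        _ = _ := one_mul _

theorem tendsto_half_pow_nhdsGT :
    Tendsto (fun k : ℕ => (1 / 2 : ℝ) ^ k) atTop (𝓝[>] 0) :=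
  tendsto_nhdsWithin_iff.2 ⟨tendsto_pow_atTop_nhds_zero_of_lt_one (by norm_num) (by norm_num),
    Eventually.of_forall fun k => by simp⟩

theorem exists_one_le_sum_Ico_inv (m : ℕ) : ∃ n, 1 ≤ ∑ k ∈ Finset.Ico m n, (k : ℝ)⁻¹ := by
  have h := Real.tendsto_sum_range_one_div_nat_succ_atTop
  obtain ⟨n, hn, hmn⟩ := ((h.eventually_ge_atTop
    (∑ k ∈ Finset.range m, (k : ℝ)⁻¹ + 1)).and (eventually_ge_atTop m)).exists
  refine ⟨n + 1, ?_⟩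
  have h2 : ∑ k ∈ Finset.range n, 1 / ((k : ℝ) + 1) = ∑ k ∈ Finset.range (n + 1), (k : ℝ)⁻¹ := by
    rw [Finset.sum_range_succ']; simp
  rw [Finset.sum_Ico_eq_sub _ (by lia : m ≤ n + 1), ← h2]
  linarith

/-- The shells are disjoint, so at most one term is nonzero at each point. -/
theorem rpow_sum_indicator_shell_le {X : Type*} [MetricSpace X] {α : ℝ} (hα : 0 < α) (x₀ : X)
    (K : Finset ℕ) {e : ℕ → ℝ}   (he : Antitone e) (c : ℕ → ℝ≥0∞) (x : X) :
    (∑ k ∈ K, (shell x₀ (e (k + 1)) (e k)).indicator (fun _ => c k) x) ^ α ≤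
      ∑ k ∈ K, (shell x₀ (e (k + 1)) (e k)).indicator (fun _ => c k ^ α) x := by
  by_cases hx : ∃ j ∈ K, x ∈ shell x₀ (e (j + 1)) (e j)
  · obtain ⟨j, hj, hxj⟩ := hx
    have hne : ∀ k, k ≠ j → x ∉ shell x₀ (e (k + 1)) (e k) := by
      intro k hkj hxk
      rcases lt_or_gt_of_ne hkj with h | h
      · exact ((hxk.1.trans_lt hxj.2).trans_le (he h)).false
      · exact ((hxj.1.trans_lt hxk.2).trans_le (he h)).false
    rw [Finset.sum_eq_single_of_mem j hj fun k _ hkj => indicator_of_notMem (hne k hkj) _,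
      Finset.sum_eq_single_of_mem j hj fun k _ hkj => indicator_of_notMem (hne k hkj) _,
      indicator_of_mem hxj, indicator_of_mem hxj]
  · push Not at hx
    rw [Finset.sum_eq_zero fun k hk => indicator_of_notMem (hx k hk) _, ENNReal.zero_rpow_of_pos hα]
    exact zero_le

theorem lintegral_mul_rpow_shell_le [BorelSpace X] {α : ℝ} (hα : 0 < α) (x₀ : X)
    {Q : X → ℝ≥0∞} (hQ : AEMeasurable Q (μ.restrict D)) (K : Finset ℕ) {e : ℕ → ℝ}
    (he : Antitone e) {c : ℕ → ℝ≥0∞} (hc : ∀ k, c k ≠ ⊤) :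
    ∫⁻ x in D, Q x *
      (∑ k ∈ K, (shell x₀ (e (k + 1)) (e k)).indicator (fun _ => c k) x) ^ α ∂μ ≤
      ∑ k ∈ K, c k ^ α * ∫⁻ x in Metric.ball x₀ (e k) ∩ D, Q x ∂μ := by
  calc _ ≤ ∫⁻ x in D, ∑ k ∈ K, c k ^ α * (shell x₀ (e (k + 1)) (e k)).indicator Q x ∂μ := by
        refine lintegral_mono fun x => ?_
        refine (mul_le_mul_right (rpow_sum_indicator_shell_le hα x₀ K he c x) _).trans ?_
        rw [Finset.mul_sum]
        refine Finset.sum_le_sum fun k _ => ?_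
        by_cases hx : x ∈ shell x₀ (e (k + 1)) (e k)
        · rw [indicator_of_mem hx, indicator_of_mem hx, mul_comm]
        · rw [indicator_of_notMem hx, indicator_of_notMem hx, mul_zero, mul_zero]
    _ = ∑ k ∈ K, c k ^ α * ∫⁻ x in shell x₀ (e (k + 1)) (e k) ∩ D, Q x ∂μ := by
        rw [lintegral_finsetSum' _ fun k _ =>
          (hQ.indicator (measurableSet_shell _ _ _)).const_mul _]
        refine Finset.sum_congr rfl fun k _ => ?_
        rw [lintegral_const_mul' _ _ (ENNReal.rpow_ne_top_of_nonneg hα.le (hc k)),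
          lintegral_indicator (measurableSet_shell _ _ _),
          Measure.restrict_restrict (measurableSet_shell _ _ _)]
    _ ≤ _ := by
        gcongr with k _
        exact fun x hx => hx.2

/-- With radii `e k = 2⁻ᵏ`, the `k`-th shell contributes `1 / (k * S)` to the length of a crossing
path and at most `η / (k * S ^ α)` to the integral. Summing over `k`, where `S` is the sum of the `1
/ k`, gives `1` and at most `η * S ^ (1 - α) ≤ η`. -/
theorem exists_admissible_lintegral_le [BorelSpace X] {Q : X → ℝ≥0∞} {x₀ : X} {lam : ℝ → ℝ}
    {α : ℝ} (hα : 1 ≤ α) (hQm : AEMeasurable Q (μ.restrict D))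
    (hreg : UpperRegularAt μ lam x₀)
    (hlam : lam =o[𝓝[>] 0] fun ε : ℝ => ε ^ α * Real.log (1 / ε) ^ (α - 1))
    (hQ : BoundedMeansAt μ D Q x₀) {ε₀ η : ℝ} (hε₀ : 0 < ε₀) (hη : 0 < η) :
    ∃ δ > 0, ∃ ρ : X → ℝ≥0∞, ∫⁻ x in D, Q x * ρ x ^ α ∂μ ≤ ENNReal.ofReal η ∧
      ∀ Γ : Set C(I, X), (∀ γ ∈ Γ, (∃ s, dist (γ s) x₀ < δ) ∧ ∃ t, ε₀ ≤ dist (γ t) x₀) →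
        Admissible Γ ρ := by
  set e : ℕ → ℝ := fun k => (1 / 2 : ℝ) ^ k with he
  have he0 : ∀ k, 0 < e k := fun k => by positivity
  have hes : ∀ k, e k - e (k + 1) = e k / 2 := fun k => by simp only [he, pow_succ]; ring
  have hanti : Antitone e := pow_right_anti₀ (by norm_num) (by norm_num)
  -- The factor `2 ^ α` is returned by the `2` in the definition of `c`.
  have hη' : 0 < η / 2 ^ α := by positivity
  have hev := tendsto_half_pow_nhdsGT.eventually (eventually_lintegral_ball_le hreg hlam hQ hη')
  have hsm := tendsto_half_pow_nhdsGT.eventually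
    (mem_nhdsWithin_of_mem_nhds (Iio_mem_nhds hε₀))
  obtain ⟨m, hm⟩ := eventually_atTop.1 (hev.and (hsm.and (eventually_ge_atTop 1)))
  obtain ⟨n, hn⟩ := exists_one_le_sum_Ico_inv m
  set S := ∑ k ∈ Finset.Ico m n, (k : ℝ)⁻¹ with hS
  have hS0 : 0 < S := one_pos.trans_le hn
  -- The `2` compensates for the shell width `e k / 2`.
  set c : ℕ → ℝ := fun k => 2 / (e k * (k * S)) with hc
  have hc0 : ∀ k, 0 ≤ c k := fun k => by have := (he0 k).le; positivity
  refine ⟨e n, he0 n, fun x => ∑ k ∈ Finset.Ico m n,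
    (shell x₀ (e (k + 1)) (e k)).indicator (fun _ => ENNReal.ofReal (c k)) x, ?_, ?_⟩
  · refine (lintegral_mul_rpow_shell_le (one_pos.trans_le hα) x₀ hQm _ hanti
      fun k => ENNReal.ofReal_ne_top).trans ?_
    calc _ ≤ ∑ k ∈ Finset.Ico m n, ENNReal.ofReal (η / S * (k : ℝ)⁻¹) := by
          refine Finset.sum_le_sum fun k hk => ?_
          obtain ⟨h1, h2, h3⟩ := hm k (Finset.mem_Ico.1 hk).1
          have hk0 : (0 : ℝ) < k := by exact_mod_cast h3
          have hek := he0 k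
          refine (mul_le_mul_right h1 _).trans ?_
          rw [ENNReal.ofReal_rpow_of_nonneg (hc0 k) (by linarith),
            ← ENNReal.ofReal_mul (Real.rpow_nonneg (hc0 k) _)]
          refine ENNReal.ofReal_le_ofReal ?_
          -- The logarithm is `k * log 2`, and `log 2 < 1`.
          have hlog : Real.log (1 / (1 / 2 : ℝ) ^ k) ≤ k := by
            rw [one_div, ← inv_pow, one_div, inv_inv, Real.log_pow]
            have := Real.log_two_lt_d9
            nlinarith
          have hlog0 : 0 ≤ Real.log (1 / (1 / 2 : ℝ) ^ k) := by
            rw [one_div, ← inv_pow, one_div, inv_inv, Real.log_pow]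
            have := Real.log_two_gt_d9
            positivity
          calc c k ^ α * (η / 2 ^ α * (e k ^ α * Real.log (1 / (1 / 2 : ℝ) ^ k) ^ (α - 1)))
              ≤ c k ^ α * (η / 2 ^ α * (e k ^ α * (k : ℝ) ^ (α - 1))) := by
                have := hc0 k
                gcongr
            _ = η * (k : ℝ)⁻¹ * (S ^ α)⁻¹ := by
                rw [hc, Real.div_rpow (by norm_num) (by positivity),
                  Real.mul_rpow hek.le (by positivity), Real.mul_rpow hk0.le hS0.le,
                  Real.rpow_sub_one hk0.ne']
                have : (2 : ℝ) ^ α ≠ 0 := by positivity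
                have : e k ^ α ≠ 0 := by positivity
                have : (k : ℝ) ^ α ≠ 0 := by positivity
                have : S ^ α ≠ 0 := by positivity
                field_simp
            _ ≤ η * (k : ℝ)⁻¹ * S⁻¹ := by
                gcongr
                exact Real.self_le_rpow_of_one_le hn hα
            _ = _ := by ring
      _ = ENNReal.ofReal η := by
          rw [← ENNReal.ofReal_sum_of_nonneg fun k _ => by positivity, ← Finset.mul_sum, ← hS,
            div_mul_cancel₀ _ hS0.ne']
  · intro Γ hΓ
    refine ⟨Finset.measurable_sum _ fun k _ =>
      measurable_const.indicator (measurableSet_shell _ _ _), fun γ hγ hr => ?_⟩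
    obtain ⟨⟨s, hs⟩, t, ht⟩ := hΓ γ hγ
    refine le_trans ?_ (sum_le_lineIntegral_shell hr _ _ _ _
      (fun k hk => ⟨s, hs.le.trans (hanti (Finset.mem_Ico.1 hk).2)⟩)
      fun k hk => ⟨t, ?_⟩)
    · have h2 : ∀ k ∈ Finset.Ico m n, ENNReal.ofReal (c k) * ENNReal.ofReal (e k - e (k + 1)) =
          ENNReal.ofReal (S⁻¹ * (k : ℝ)⁻¹) := by
        intro k _
        rw [← ENNReal.ofReal_mul (hc0 k), hes, hc]
        congr 1
        have := (he0 k).ne'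
        field_simp
      rw [Finset.sum_congr rfl h2, ← ENNReal.ofReal_sum_of_nonneg fun k _ => by positivity,
        ← Finset.mul_sum, ← hS, inv_mul_cancel₀ hS0.ne', ENNReal.ofReal_one]
    · exact ((hm k (Finset.mem_Ico.1 hk).1).2.1.le).trans ht

end MetricModulus

namespace MetricModulus

/-! ### Cluster sets at boundary points and extension to the closures -/

section Cluster

variable {X X' : Type*} [MetricSpace X] [MetricSpace X'] {D : Set X} {D' : Set X'}

theorem exists_mem_of_mapClusterPt {f : D → X'} {x₀ : X} {p : X'}
    (hp : MapClusterPt p (comap (Subtype.val : D → X) (𝓝 x₀)) f) {δ : ℝ} (hδ : 0 < δ)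
    {W : Set X'} (hW : W ∈ 𝓝 p) : ∃ x : D, dist (x : X) x₀ < δ ∧ f x ∈ W :=
  ((hp.frequently hW).and_eventually
    (preimage_mem_comap (Metric.ball_mem_nhds x₀ hδ))).exists.imp fun _ h => h.symm

/-- If `p` were in `D'`, continuity of the inverse would keep points with values near `p` close to
the preimage of `p`, hence away from `x₀`. -/
theorem mem_frontier_of_mapClusterPt (hD : IsOpen D) (hD' : IsOpen D') (f : D ≃ₜ D') {x₀ : X}
    (hx₀ : x₀ ∈ frontier D) {p : X'}
    (hp : MapClusterPt p (comap (Subtype.val : D → X) (𝓝 x₀)) fun x => (f x : X')) :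
    p ∈ frontier D' := by
  rw [hD'.frontier_eq]
  rw [hD.frontier_eq] at hx₀
  refine ⟨mem_closure_iff_nhds.2 fun W hW => ?_, fun hpD => ?_⟩
  · obtain ⟨x, -, hx⟩ := exists_mem_of_mapClusterPt hp one_pos hW
    exact ⟨_, hx, (f x).2⟩
  · have ha : (f.symm ⟨p, hpD⟩ : X) ≠ x₀ := fun h => hx₀.2 (h ▸ (f.symm ⟨p, hpD⟩).2)
    have hd := dist_pos.2 ha
    have hN : f '' (Subtype.val ⁻¹' Metric.ball (f.symm ⟨p, hpD⟩ : X)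
        (dist (f.symm ⟨p, hpD⟩ : X) x₀ / 2)) ∈ 𝓝 (⟨p, hpD⟩ : D') := by
      refine (f.isOpenMap _ (Metric.isOpen_ball.preimage continuous_subtype_val)).mem_nhds
        ⟨f.symm ⟨p, hpD⟩, Metric.mem_ball_self (half_pos hd), by simp⟩
    obtain ⟨W, hW, hWsub⟩ := mem_comap.1 ((nhds_subtype_eq_comap (p := (· ∈ D'))) ▸ hN)
    obtain ⟨x, hx, hxW⟩ := exists_mem_of_mapClusterPt hp (half_pos hd) hW
    obtain ⟨x', hx', hxx⟩ := hWsub hxW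
    rw [f.injective hxx] at hx'
    have h1 : dist (x : X) (f.symm ⟨p, hpD⟩ : X) < dist (f.symm ⟨p, hpD⟩ : X) x₀ / 2 := hx'
    have := dist_triangle_left (f.symm ⟨p, hpD⟩ : X) x₀ (x : X)
    linarith

/-- The continuum is the image of a path in `A`; `C` is the trace of that path and records where the
preimage of the continuum lies. -/
theorem exists_isContinuum_of_joinedIn (f : D ≃ₜ D') {A : Set X} (hA : A ⊆ D) {x y : D}
    (h : JoinedIn A (x : X) y) :
    ∃ (E : Set X') (C : Set X), IsContinuum E ∧ E ⊆ D' ∧ (f x : X') ∈ E ∧ (f y : X') ∈ E ∧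
      IsCompact C ∧ C ⊆ A ∧ ∀ z : D, (f z : X') ∈ E → (z : X) ∈ C := by
  obtain ⟨γ, hγ⟩ := h
  have hc : Continuous fun t : I => (f ⟨γ t, hA (hγ t)⟩ : X') :=
    continuous_subtype_val.comp (f.continuous.comp (γ.continuous.subtype_mk _))
  refine ⟨range fun t : I => (f ⟨γ t, hA (hγ t)⟩ : X'), range γ,
    ⟨isCompact_range hc, isConnected_range hc⟩, ?_, ⟨0, by simp⟩, ⟨1, by simp⟩,
    isCompact_range γ.continuous, range_subset_iff.2 hγ, ?_⟩
  · rintro _ ⟨t, rfl⟩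
    exact (f _).2
  · rintro z ⟨t, ht⟩
    exact ⟨t, congrArg Subtype.val (f.injective (Subtype.ext ht))⟩

variable [MeasurableSpace X] [MeasurableSpace X'] {μ : Measure X} {μ' : Measure X'}
  {Q : X → ℝ≥0∞} {f : D ≃ₜ D'}

/-- The cluster sets of a `Q`-homeomorphism at distinct boundary points are disjoint. -/
theorem IsQHomeo.eq_of_mapClusterPt (hf : IsQHomeo μ μ' Q f) (hD : IsDomainIn D)
    (hD' : IsOpen D') (hμ : μ D ≠ ⊤) (hflat : WeaklyFlatBoundary μ D)
    (hflat' : WeaklyFlatBoundary μ' D') (hQ : ∫⁻ x in D, Q x ∂μ ≠ ⊤) {x₁ x₂ : X}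
    (hx₁ : x₁ ∈ frontier D) (hx₂ : x₂ ∈ frontier D) {p : X'}
    (hp₁ : MapClusterPt p (comap (Subtype.val : D → X) (𝓝 x₁)) fun x => (f x : X'))
    (hp₂ : MapClusterPt p (comap (Subtype.val : D → X) (𝓝 x₂)) fun x => (f x : X')) :
    x₁ = x₂ := by
  by_contra hne
  have hd := dist_pos.2 hne
  set r := dist x₁ x₂ / 4 with hr
  have hr0 : 0 < r := by positivity
  have hp := mem_frontier_of_mapClusterPt hD.1 hD' f hx₁ hp₁
  have hpD' : p ∉ D' := fun h => (hD'.frontier_eq ▸ hp).2 h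
  obtain ⟨δ₁, hδ₁, hj₁⟩ := (hflat x₁ hx₁).exists_joinedIn hD.2 hμ hr0
  obtain ⟨δ₂, hδ₂, hj₂⟩ := (hflat x₂ hx₂).exists_joinedIn hD.2 hμ hr0
  obtain ⟨a₁, ha₁, -⟩ := exists_mem_of_mapClusterPt hp₁ hδ₁ univ_mem
  obtain ⟨a₂, ha₂, -⟩ := exists_mem_of_mapClusterPt hp₂ hδ₂ univ_mem
  have hfa : ∀ a : D, 0 < dist (f a : X') p := fun a =>
    dist_pos.2 fun h => hpD' (h ▸ (f a).2)
  set c : ℝ≥0∞ := ENNReal.ofReal (2 * r)⁻¹ with hc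
  have hcα : c ^ hdim D ≠ ⊤ :=
    ENNReal.rpow_ne_top_of_nonneg ENNReal.toReal_nonneg ENNReal.ofReal_ne_top
  have hM : (∫⁻ x in D, Q x ∂μ) * c ^ hdim D ≠ ⊤ := ENNReal.mul_ne_top hQ hcα
  -- The radius puts both fixed values `f a₁` and `f a₂` outside the ball. The points `b₁`, `b₂` are
  -- chosen only afterwards, with values inside `V`.
  obtain ⟨V, hV, hVU, hfl⟩ := hflat' p hp (((∫⁻ x in D, Q x ∂μ) * c ^ hdim D).toNNReal + 1)
    (by positivity) (Metric.ball p (min (dist (f a₁ : X') p) (dist (f a₂ : X') p)))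
    (Metric.ball_mem_nhds _ (lt_min (hfa a₁) (hfa a₂)))
  obtain ⟨b₁, hb₁, hb₁V⟩ := exists_mem_of_mapClusterPt hp₁ hδ₁ (interior_mem_nhds.2 hV)
  obtain ⟨b₂, hb₂, hb₂V⟩ := exists_mem_of_mapClusterPt hp₂ hδ₂ (interior_mem_nhds.2 hV)
  obtain ⟨E, C₁, hE, hED, hbE, haE, -, hC₁, hEC⟩ := exists_isContinuum_of_joinedIn f
    inter_subset_left (hj₁ b₁ b₁.2 a₁ a₁.2 hb₁ ha₁)
  obtain ⟨F, C₂, hF, hFD, hbF, haF, -, hC₂, hFC⟩ := exists_isContinuum_of_joinedIn f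
    inter_subset_left (hj₂ b₂ b₂.2 a₂ a₂.2 hb₂ ha₂)
  have ha₁U : (f a₁ : X') ∉ Metric.ball p (min (dist (f a₁ : X') p) (dist (f a₂ : X') p)) :=
    fun h => ((Metric.mem_ball.1 h).trans_le (min_le_left _ _)).false
  have ha₂U : (f a₂ : X') ∉ Metric.ball p (min (dist (f a₁ : X') p) (dist (f a₂ : X') p)) :=
    fun h => ((Metric.mem_ball.1 h).trans_le (min_le_right _ _)).false
  have hadm : Admissible (ambient {γ : C(I, D) | (f (γ 0) : X') ∈ E ∧ (f (γ 1) : X') ∈ F})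
      fun _ => c := by
    refine admissible_const (by positivity) ?_
    rintro _ ⟨γ, hγ, rfl⟩
    refine ⟨0, 1, ?_⟩
    have h0 : dist (γ 0 : X) x₁ < r := (hC₁ (hEC _ hγ.1)).2
    have h1 : dist (γ 1 : X) x₂ < r := (hC₂ (hFC _ hγ.2)).2
    have h2 := dist_triangle_left x₁ x₂ (γ 0 : X)
    have h3 := dist_triangle (γ 0 : X) (γ 1 : X) x₂
    change 2 * r ≤ dist (γ 0 : X) (γ 1 : X)
    linarith
  have h1 := (hfl E F hE hF hED hFD
    (inter_frontier_nonempty hE.2.isPreconnected hbE (interior_mono hVU hb₁V) haE ha₁U)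
    (inter_frontier_nonempty hE.2.isPreconnected hbE hb₁V haE fun h => ha₁U (hVU h))
    (inter_frontier_nonempty hF.2.isPreconnected hbF (interior_mono hVU hb₂V) haF ha₂U)
    (inter_frontier_nonempty hF.2.isPreconnected hbF hb₂V haF fun h => ha₂U (hVU h))).trans
    (hf.modulus_joining_le hED hFD hadm)
  rw [lintegral_mul_const' _ _ hcα, ENNReal.coe_add, ENNReal.coe_toNNReal hM] at h1
  exact (ENNReal.lt_add_right hM one_ne_zero).not_ge h1

/-- The cluster set of a `Q`-homeomorphism at a boundary point has at most one point. -/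
theorem IsQHomeo.mapClusterPt_unique [BorelSpace X] (hf : IsQHomeo μ μ' Q f)
    (hD : IsDomainIn D) (hD' : IsOpen D') (hfin : dimH D ≠ ⊤) (hμ : μ D ≠ ⊤)
    (hflat : WeaklyFlatBoundary μ D) (hflat' : WeaklyFlatBoundary μ' D')
    (hQm : AEMeasurable Q (μ.restrict D)) {x₀ : X} (hx₀ : x₀ ∈ frontier D) {lam : ℝ → ℝ}
    (hreg : UpperRegularAt μ lam x₀)
    (hlam : lam =o[𝓝[>] 0] fun ε : ℝ => ε ^ hdim D * Real.log (1 / ε) ^ (hdim D - 1))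
    (hQ : BoundedMeansAt μ D Q x₀) {p q : X'}
    (hp : MapClusterPt p (comap (Subtype.val : D → X) (𝓝 x₀)) fun x => (f x : X'))
    (hq : MapClusterPt q (comap (Subtype.val : D → X) (𝓝 x₀)) fun x => (f x : X')) :
    p = q := by
  by_contra hne
  have hd := dist_pos.2 hne
  have hx₀' := hx₀
  rw [hD.1.frontier_eq] at hx₀'
  -- A one-point domain is closed and so has no boundary point outside itself.
  have hα : 1 ≤ hdim D := by
    obtain ⟨y, hy⟩ := hD.2.nonempty
    obtain ⟨z, hz, hzy⟩ : ∃ z ∈ D, z ≠ y := by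
      by_contra! hall
      have h1 : closure D ⊆ {y} := closure_minimal hall isClosed_singleton
      exact hx₀'.2 (h1 hx₀'.1 ▸ hy)
    exact one_le_hdim hD.2 hfin hz hy hzy
  -- `V` is fixed with `P = 1` before any scale in `D`, so one continuum `F` can be fixed and `E`
  -- taken from arbitrarily near `x₀`. A modulus bound of `1 / 2` is then a contradiction.
  obtain ⟨V, hV, hVU, hfl⟩ := hflat' p (mem_frontier_of_mapClusterPt hD.1 hD' f hx₀ hp) 1
    one_pos (Metric.ball p (dist p q / 2)) (Metric.ball_mem_nhds _ (half_pos hd))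
  have hnear : ∀ δ > 0, ∃ a b : D, dist (a : X) x₀ < δ ∧ dist (b : X) x₀ < δ ∧
      (f a : X') ∈ interior V ∧ (f b : X') ∉ Metric.ball p (dist p q / 2) := by
    intro δ hδ
    obtain ⟨a, ha, haV⟩ := exists_mem_of_mapClusterPt hp hδ (interior_mem_nhds.2 hV)
    obtain ⟨b, hb, hbq⟩ := exists_mem_of_mapClusterPt hq hδ
      (Metric.ball_mem_nhds q (half_pos hd))
    refine ⟨a, b, ha, hb, haV, fun h => ?_⟩
    have h1 : dist (f b : X') q < dist p q / 2 := hbq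
    have h2 : dist (f b : X') p < dist p q / 2 := h
    have := dist_triangle_left p q (f b : X')
    linarith
  obtain ⟨a, b, -, -, haV, hbU⟩ := hnear 1 one_pos
  obtain ⟨F, K, hF, hFD, haF, hbF, hK, hKD, hFK⟩ := exists_isContinuum_of_joinedIn f
    Subset.rfl (hD.2.joinedIn a a.2 b b.2)
  -- The preimage of `F` lies in the compact set `K ⊆ D`, which misses `x₀`.
  obtain ⟨ε₀, hε₀, hball⟩ := Metric.mem_nhds_iff.1
    (hK.isClosed.isOpen_compl.mem_nhds fun h => hx₀'.2 (hKD h))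
  obtain ⟨δ, hδ, ρ, hρ, hadm⟩ := exists_admissible_lintegral_le hα hQm hreg hlam hQ hε₀
    (η := 1 / 2) (by norm_num)
  obtain ⟨δ', hδ', hj⟩ := (hflat x₀ hx₀).exists_joinedIn hD.2 hμ hδ
  obtain ⟨a', b', ha', hb', haV', hbU'⟩ := hnear δ' hδ'
  obtain ⟨E, C, hE, hED, haE, hbE, -, hC, hEC⟩ := exists_isContinuum_of_joinedIn f
    inter_subset_left (hj a' a'.2 b' b'.2 ha' hb')
  have h1 := (hfl E F hE hF hED hFD
    (inter_frontier_nonempty hE.2.isPreconnected haE (interior_mono hVU haV') hbE hbU')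
    (inter_frontier_nonempty hE.2.isPreconnected haE haV' hbE fun h => hbU' (hVU h))
    (inter_frontier_nonempty hF.2.isPreconnected haF (interior_mono hVU haV) hbF hbU)
    (inter_frontier_nonempty hF.2.isPreconnected haF haV hbF fun h => hbU (hVU h))).trans
    ((hf.modulus_joining_le hED hFD (hadm _ ?_)).trans hρ)
  · rw [ENNReal.coe_one, ENNReal.one_le_ofReal] at h1
    norm_num at h1
  · rintro _ ⟨γ, hγ, rfl⟩
    exact ⟨⟨0, (hC (hEC _ hγ.1)).2⟩, 1, not_lt.1 fun h => hball h (hFK _ hγ.2)⟩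

end Cluster

/-- A homeomorphism between open sets with compact closures extends to the closures as soon as
its cluster sets at boundary points are singletons, distinct for distinct points. -/
theorem exists_homeomorph_closure {X X' : Type*} [MetricSpace X] [MetricSpace X']
    {D : Set X} {D' : Set X'} (hD : IsOpen D) (hD' : IsOpen D') (hcpt : IsCompact (closure D))
    (hcpt' : IsCompact (closure D')) (f : D ≃ₜ D')
    (huniq : ∀ x₀ ∈ frontier D, ∀ p q,
      MapClusterPt p (comap (Subtype.val : D → X) (𝓝 x₀)) (fun x => (f x : X')) →
      MapClusterPt q (comap (Subtype.val : D → X) (𝓝 x₀)) (fun x => (f x : X')) → p = q)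
    (hdisj : ∀ x₁ ∈ frontier D, ∀ x₂ ∈ frontier D, ∀ p,
      MapClusterPt p (comap (Subtype.val : D → X) (𝓝 x₁)) (fun x => (f x : X')) →
      MapClusterPt p (comap (Subtype.val : D → X) (𝓝 x₂)) (fun x => (f x : X')) → x₁ = x₂) :
    ∃ F : closure D ≃ₜ closure D', ∀ x : D, (F ⟨x, subset_closure x.2⟩ : X') = f x := by
  have hcs : CompactSpace (closure D) := isCompact_iff_compactSpace.1 hcpt
  set g : D → X' := fun x => (f x : X') with hg
  have hgc : Continuous g := continuous_subtype_val.comp f.continuous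
  have hgD : ∀ x, g x ∈ closure D' := fun x => subset_closure (f x).2
  set i : D → closure D := inclusion subset_closure with hi
  have hdi : IsDenseInducing i := by
    refine ⟨(IsEmbedding.inclusion subset_closure).isInducing, ?_⟩
    rw [hi]
    exact denseRange_inclusion_iff _ |>.2 Subset.rfl
  have hcomap : ∀ b : closure D, comap i (𝓝 b) = comap (Subtype.val : D → X) (𝓝 (b : X)) := by
    intro b
    rw [nhds_subtype_eq_comap, comap_comap]
    rfl
  have hlim : ∀ b : closure D, ∃ c, Tendsto g (comap i (𝓝 b)) (𝓝 c) := by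
    intro b
    by_cases hb : (b : X) ∈ D
    · refine ⟨g ⟨b, hb⟩, ?_⟩
      change Tendsto g (comap i (𝓝 (i ⟨b, hb⟩))) _
      rw [← hdi.nhds_eq_comap]
      exact hgc.continuousAt
    · have hbf : (b : X) ∈ frontier D := by
        rw [hD.frontier_eq]; exact ⟨b.2, hb⟩
      have := hdi.comap_nhds_neBot b
      obtain ⟨c, -, hc⟩ := hcpt' (f := map g (comap i (𝓝 b)))
        (le_principal_iff.2 (mem_map.2 (univ_mem' hgD)))
      -- In a compact set, a filter with a single cluster point converges to it.
      refine ⟨c, hcpt'.le_nhds_of_unique_clusterPt (mem_map.2 (univ_mem' hgD)) fun q _ hq => ?_⟩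
      rw [hcomap] at hc hq
      exact huniq b hbf q c hq hc
  have hext : Continuous (hdi.extend g) := hdi.continuous_extend hlim
  have hexti : ∀ x : D, hdi.extend g (i x) = g x := fun x => hdi.extend_eq hgc x
  have hclus : ∀ b : closure D,
      MapClusterPt (hdi.extend g b) (comap (Subtype.val : D → X) (𝓝 (b : X))) g := by
    intro b
    have := hdi.comap_nhds_neBot b
    obtain ⟨c, hc⟩ := hlim b
    rw [hdi.extend_eq_of_tendsto hc, ← hcomap]
    exact hc.mapClusterPt
  have hmem : ∀ b, hdi.extend g b ∈ closure D' := fun b =>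
    isClosed_closure.mem_of_mapClusterPt (hclus b) (Eventually.of_forall hgD)
  have hbdry : ∀ b : closure D, (b : X) ∉ D → hdi.extend g b ∉ D' := by
    intro b hb
    have := mem_frontier_of_mapClusterPt hD hD' f (hD.frontier_eq ▸ ⟨b.2, hb⟩) (hclus b)
    rw [hD'.frontier_eq] at this
    exact this.2
  have hin : ∀ b : closure D, ∀ hb : (b : X) ∈ D, hdi.extend g b = f ⟨b, hb⟩ := fun b hb =>
    hexti ⟨b, hb⟩
  set G : closure D → closure D' := fun b => ⟨hdi.extend g b, hmem b⟩ with hG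
  have hGc : Continuous G := hext.subtype_mk _
  have hinj : Function.Injective G := by
    intro b₁ b₂ h
    have h' : hdi.extend g b₁ = hdi.extend g b₂ := congrArg Subtype.val h
    by_cases h1 : (b₁ : X) ∈ D <;> by_cases h2 : (b₂ : X) ∈ D
    · rw [hin b₁ h1, hin b₂ h2] at h'
      have h3 := f.injective (Subtype.ext h')
      exact Subtype.ext (congrArg (Subtype.val : D → X) h3)
    · exact (hbdry b₂ h2 (h' ▸ hin b₁ h1 ▸ (f _).2)).elim
    · exact (hbdry b₁ h1 (h' ▸ hin b₂ h2 ▸ (f _).2)).elim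
    · exact Subtype.ext (hdisj _ (hD.frontier_eq ▸ ⟨b₁.2, h1⟩) _ (hD.frontier_eq ▸ ⟨b₂.2, h2⟩) _
        (hclus b₁) (h' ▸ hclus b₂))
  have hsurj : Function.Surjective G := by
    -- The range of the extension is compact, hence closed, and contains `D'`.
    have hrange : closure D' ⊆ range (hdi.extend g) := by
      refine closure_minimal (fun y hy => ⟨i (f.symm ⟨y, hy⟩), ?_⟩) (isCompact_range hext).isClosed
      rw [hexti]
      simp [hg]
    intro y
    obtain ⟨b, hb⟩ := hrange y.2
    exact ⟨b, Subtype.ext hb⟩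
  exact ⟨Continuous.homeoOfEquivCompactToT2 (f := Equiv.ofBijective G ⟨hinj, hsurj⟩) hGc,
    fun x => hexti x⟩

end MetricModulus

theorem theorem3p2 {X X' : Type*}
    [MetricSpace X] [MeasurableSpace X] [BorelSpace X]
    [MetricSpace X'] [MeasurableSpace X'] [BorelSpace X']
    (μ : Measure X) [IsLocallyFiniteMeasure μ]
    (μ' : Measure X') [IsLocallyFiniteMeasure μ']
    (D : Set X) (D' : Set X')
    (hD : MetricModulus.IsDomainIn D) (hD' : MetricModulus.IsDomainIn D')
    (hdimD : dimH D ≠ ⊤) (hdimD' : dimH D' ≠ ⊤)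
    (hflat : MetricModulus.WeaklyFlatBoundary μ D)
    (hflat' : MetricModulus.WeaklyFlatBoundary μ' D')
    (hcpt : IsCompact (closure D)) (hcpt' : IsCompact (closure D'))
    (lam : X → ℝ → ℝ)
    (hreg : ∀ x₀ ∈ frontier D, MetricModulus.UpperRegularAt μ (lam x₀) x₀)
    (hlam : ∀ x₀ ∈ frontier D, lam x₀ =o[𝓝[>] 0] fun ε : ℝ =>
      ε ^ MetricModulus.hdim D * Real.log (1 / ε) ^ (MetricModulus.hdim D - 1))
    (Q : X → ℝ≥0∞) (hQmeas : AEMeasurable Q (μ.restrict D))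
    (hQint : ∫⁻ x in D, Q x ∂μ < ⊤)
    (hQmean : ∀ x₀ ∈ frontier D, MetricModulus.BoundedMeansAt μ D Q x₀)
    (f : D ≃ₜ D') (hf : MetricModulus.IsQHomeo μ μ' Q f) :
    ∃ F : closure D ≃ₜ closure D', ∀ x : D,
      (F ⟨x, subset_closure x.2⟩ : X') = f x := by
  have hμ : μ D ≠ ⊤ := ((measure_mono subset_closure).trans_lt hcpt.measure_lt_top).ne
  exact MetricModulus.exists_homeomorph_closure hD.1 hD'.1 hcpt hcpt' f
    (fun x₀ hx₀ _ _ hp hq => hf.mapClusterPt_unique hD hD'.1 hdimD hμ hflat hflat' hQmeas hx₀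
      (hreg x₀ hx₀) (hlam x₀ hx₀) (hQmean x₀ hx₀) hp hq)
    (fun _ hx₁ _ hx₂ _ hp₁ hp₂ => hf.eq_of_mapClusterPt hD hD'.1 hμ hflat hflat' hQint.ne
      hx₁ hx₂ hp₁ hp₂)
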